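/- Let $A=\bigoplus_{i\in I}B(H_{\mathrm{in},i})$, $B=\bigoplus_{j\in J}B(H_{\mathrm{out},j})$, $C=\bigoplus_{k\in K}B(K_{\mathrm{in},k})$, $D=\bigoplus_{l\in L}B(K_{\mathrm{out},l})$, where $I,J,K,L$ are finite sets and all the Hilbert spaces are finite-dimensional with fixed orthonormal bases, so that $A,B,C,D$ are direct sums of matrix algebras. A \emph{channel} is a completely positive trace-preserving linear map between such algebras. Let $$\underline{\mathrm{Hom}}(A,B)=\bigoplus_{j\in J,\,i\in I}B(H_{\mathrm{out},j}\otimes H_{\mathrm{in},i}^{*}),$$ and let the Choi operator $\widetilde\Phi\in\underline{\mathrm{Hom}}(A,B)$ of a linear map $\Phi:A\to B$ be the element with blocks $\widetilde\Phi_{ji}=\sum_{r,s}\Phi(|r\rangle\langle s|)_j\otimes|r\rangle\langle s|$, where $|r\rangle\langle s|$ runs through the matrix units of $B(H_{\mathrm{in},i})$, and the second factor is read as a matrix on $H_{\mathrm{in},i}^{*}$ in the dual basis; $\Phi\mapsto\widetilde\Phi$ is a linear bijection. An element $X\in\underline{\mathrm{Hom}}(A,B)$ obeys (TP) if $\sum_{j}\mathrm{Tr}_{H_{\mathrm{out},j}}(X_{ji})=\mathrm{id}_{H_{\mathrm{in},i}^{*}}$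 for all $i\in I$. The same definitions apply to $C,D$. A \emph{deterministic supermap} $\mathcal S$ from channels $A\to B$ to channels $C\to D$ is a completely positive map $\underline{\mathrm{Hom}}(A,B)\to\underline{\mathrm{Hom}}(C,D)$ which sends positive elements obeying (TP) to positive elements obeying (TP). For a channel $\mathcal F:A\to B$, let $\mathcal S(\mathcal F):C\to D$ be the linear map whose Choi operator is $\mathcal S(\widetilde{\mathcal F})$. For every deterministic supermap $\mathcal S$ from channels $A\to B$ to channels $C\to D$ there exist a Hilbert space $P$ with $$\dim P\le\max_{i\in I,\,k\in K}\dim(H_{\mathrm{in},i})\dim(K_{\mathrm{in},k})$$ (the maximum over the empty set being $0$), a channel $\mathcal E:C\to A\otimes B(P)$ and a channel $\mathcal G:\bigoplus_{i\in I,\,k\in K}B\otimes B(P)\to D$, such that for every channel $\mathcal F:A\to B$ the map $\mathcal S(\mathcal F)$ is equal to the following circuit, applied to a state of $C$. (1) The classical index $k\in K$ is copied. (2) One copy of $k$ and the quantum state in $B(K_{\mathrm{in},k})$ are input to $\mathcal E$. (3) The classical outcome $i\in I$ of $\mathcal E$ is copied. (4) One copy of $i$ and the state of $B(H_{\mathrm{in},i})$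 are input to $\mathcal F$, while the ancilla $B(P)$, the other copy of $i$ and the other copy of $k$ are left untouched. (5) The classical indices $i,j,k$, where $j\in J$ is the outcome of $\mathcal F$, and the state of $B(H_{\mathrm{out},j})\otimes B(P)$ are input to $\mathcal G$, whose output is the output of the circuit. As a formula, writing $\iota_k:B(K_{\mathrm{in},k})\to C$ and $\iota_i:B(H_{\mathrm{in},i})\otimes B(P)\to A\otimes B(P)$ for the inclusions of summands, for $\rho=(\rho_k)_k\in C$, $$\mathcal S(\mathcal F)(\rho)=\mathcal G\Big(\big((\mathcal F\otimes\mathrm{id}_{B(P)})(\iota_i(\mathcal E(\iota_k\rho_k)_i))\big)_{i\in I,\,k\in K}\Big).$$ -/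

import Mathlib

open scoped CStarAlgebra ComplexOrder

noncomputable section

namespace Supermaps

/-- The finite-dimensional C⋆-algebra `⨁ i, B(ℂ^(n i))`, a finite direct sum of matrix algebras.
Here `n i` is the finite type that labels an orthonormal basis of the `i`-th Hilbert space.
Order, norm and star are Mathlib's: the C⋆-algebra structure of the matrix algebras, taken
componentwise. -/
abbrev MultiMat {I : Type*} (n : I → Type*) : Type _ :=
  (i : I) → CStarMatrix (n i) (n i) ℂ

section Basic

variable {I J : Type*} (n : I → Type*) (m : J → Type*)

/-- The usual matrix trace on `⨁ i, B(ℂ^(n i))`, the sum of the traces of the blocks. -/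
def MultiMat.trace {I : Type*} [Fintype I] {n : I → Type*} [∀ i, Fintype (n i)]
    (a : MultiMat n) : ℂ :=
  ∑ i, ∑ r, a i r r

/-- A channel: a completely positive trace-preserving map between finite-dimensional
C⋆-algebras. -/
structure Channel [Fintype I] [Fintype J] [∀ i, Fintype (n i)] [∀ j, Fintype (m j)]
    [∀ i, DecidableEq (n i)] [∀ j, DecidableEq (m j)]
    extends MultiMat n →CP MultiMat m where
  trace_map : ∀ a : MultiMat n, (toLinearMap a).trace = a.trace

/-- The index family of the Choi algebra: the block labelled by `(j, i)` acts on the Hilbert space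
`ℂ^(m j) ⊗ (ℂ^(n i))^*`, the dual space being given the dual basis. -/
abbrev ChoiIndex : J × I → Type _ := fun x => m x.1 × n x.2

/-- The Choi algebra `Hom(A, B)` of `A = ⨁ i, B(ℂ^(n i))` and `B = ⨁ j, B(ℂ^(m j))`, namely
`⨁ (j, i), B(ℂ^(m j) ⊗ (ℂ^(n i))^*)`. -/
abbrev ChoiAlg : Type _ := MultiMat (ChoiIndex n m)

end Basic

section Choi

variable {I J : Type*} {n : I → Type*} {m : J → Type*}

/-- The condition (TP) on an element of the Choi algebra: tracing out the output system (all
indices `j`, and the Hilbert space `ℂ^(m j)` for each of them) leaves the identity of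
`⨁ i, B((ℂ^(n i))^*)`. -/
def ChoiAlg.IsTP [Fintype J] [∀ j, Fintype (m j)] [∀ i, DecidableEq (n i)]
    (X : ChoiAlg n m) : Prop :=
  ∀ i, CStarMatrix.ofMatrix (Matrix.of fun r s => ∑ j, ∑ p, X (j, i) (p, r) (p, s)) =
    (1 : CStarMatrix (n i) (n i) ℂ)

/-- The matrix unit `|r⟩⟨s|` of the `i`-th summand of `⨁ i, B(ℂ^(n i))`. -/
def matrixUnit [DecidableEq I] [∀ i, DecidableEq (n i)] (i : I) (r s : n i) : MultiMat n :=
  Pi.single i (CStarMatrix.ofMatrix (Matrix.single r s (1 : ℂ)))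

theorem sum_block_apply {α : Type*} (t : Finset α) (f : α → MultiMat n) (i : I) (p q : n i) :
    (∑ x ∈ t, f x) i p q = ∑ x ∈ t, f x i p q := by
  rw [Finset.sum_apply]
  exact Matrix.sum_apply p q t (fun x => (f x i : Matrix (n i) (n i) ℂ))

theorem sum_matrixUnit [Fintype I] [DecidableEq I] [∀ i, Fintype (n i)]
    [∀ i, DecidableEq (n i)] (a : MultiMat n) :
    ∑ i, ∑ r, ∑ s, a i r s • matrixUnit (n := n) i r s = a := by
  funext i
  ext p q
  simp only [Finset.sum_apply, Pi.smul_apply]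
  rw [Finset.sum_eq_single i]
  · simp_rw [matrixUnit, Pi.single_eq_same]
    have h := congrFun (congrFun (Matrix.matrix_eq_sum_single
      (fun r s => a i r s : Matrix (n i) (n i) ℂ)) p) q
    simp only [Matrix.sum_apply] at h
    rw [h]
    have e1 : ∀ (f : n i → CStarMatrix (n i) (n i) ℂ), (∑ r, f r) p q = ∑ r, f r p q :=
      fun f => Matrix.sum_apply p q Finset.univ (fun r => (f r : Matrix (n i) (n i) ℂ))
    rw [e1]
    refine Finset.sum_congr rfl fun r _ => ?_
    rw [e1]
    refine Finset.sum_congr rfl fun s _ => ?_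
    rw [CStarMatrix.smul_apply, CStarMatrix.ofMatrix_apply]
    simp [Matrix.single]
  · intro j _ hj
    simp [matrixUnit, Pi.single_eq_of_ne hj.symm]
  · simp

/-- The Choi correspondence between linear maps `A → B` and elements of `Hom(A, B)`: the block
`(j, i)` of the Choi operator of `Φ` is the matrix `∑ r s, Φ(|r⟩⟨s|)_j ⊗ |r⟩⟨s|`, where `|r⟩⟨s|`
runs through the matrix units of the `i`-th summand of `A`. -/
def choi [Fintype I] [DecidableEq I] [∀ i, Fintype (n i)] [∀ i, DecidableEq (n i)] :
    (MultiMat n →ₗ[ℂ] MultiMat m) ≃ₗ[ℂ] ChoiAlg n m where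
  toFun Φ := fun x => CStarMatrix.ofMatrix <| Matrix.of fun p q =>
    Φ (matrixUnit x.2 p.2 q.2) x.1 p.1 q.1
  map_add' _ _ := rfl
  map_smul' _ _ := rfl
  invFun X :=
    { toFun := fun a j => CStarMatrix.ofMatrix <| Matrix.of fun p q =>
        ∑ i, ∑ r, ∑ s, a i r s * X (j, i) (p, r) (q, s)
      map_add' := by
        intro a b
        funext j
        ext p q
        simp [add_mul, Finset.sum_add_distrib]
      map_smul' := by
        intro c a
        funext j
        ext p q
        simp [Finset.mul_sum, mul_assoc] }
  left_inv Φ := by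
    apply LinearMap.ext
    intro a
    funext j
    ext p q
    conv_rhs => rw [← sum_matrixUnit a]
    simp [map_sum, map_smul, sum_block_apply]
  right_inv X := by
    funext x
    ext p q
    obtain ⟨j, i⟩ := x
    obtain ⟨p1, p2⟩ := p
    obtain ⟨q1, q2⟩ := q
    simp only [LinearMap.coe_mk, AddHom.coe_mk, CStarMatrix.ofMatrix_apply, Matrix.of_apply]
    rw [Finset.sum_eq_single i, Finset.sum_eq_single p2, Finset.sum_eq_single q2]
    · simp [matrixUnit]
    · intro s _ hs
      simp [matrixUnit, hs.symm]
    · simp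
    · intro r _ hr
      simp [matrixUnit, Matrix.single_apply_of_row_ne hr.symm]
    · simp
    · intro i' _ hi
      simp [matrixUnit, Pi.single_eq_of_ne hi]
    · simp

end Choi

section Supermap

variable {I J K L : Type*} (hin : I → Type*) (hout : J → Type*) (kin : K → Type*)
  (kout : L → Type*)
  [Fintype I] [Fintype J] [Fintype K] [Fintype L]
  [∀ i, Fintype (hin i)] [∀ j, Fintype (hout j)] [∀ k, Fintype (kin k)] [∀ l, Fintype (kout l)]
  [∀ i, DecidableEq (hin i)] [∀ j, DecidableEq (hout j)] [∀ k, DecidableEq (kin k)]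
  [∀ l, DecidableEq (kout l)]

/-- A deterministic supermap from channels `A → B` to channels `C → D`: a completely positive map
`Hom(A, B) → Hom(C, D)` that sends positive elements obeying (TP) to positive elements obeying
(TP). -/
structure DeterministicSupermap extends ChoiAlg hin hout →CP ChoiAlg kin kout where
  map_tp : ∀ X : ChoiAlg hin hout, 0 ≤ X → X.IsTP →
    0 ≤ toLinearMap X ∧ ChoiAlg.IsTP (n := kin) (m := kout) (toLinearMap X)

variable {hin hout kin kout}

/-- The map `𝒮(ℱ) : C → D`, whose Choi operator is the image under `𝒮` of the Choi operator of
`ℱ : A → B`. -/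
def DeterministicSupermap.onChannel [DecidableEq I] [DecidableEq K]
    (S : DeterministicSupermap hin hout kin kout) (F : Channel hin hout) :
    MultiMat kin →ₗ[ℂ] MultiMat kout :=
  choi.symm (S.toLinearMap (choi F.toLinearMap))

end Supermap

section Circuit

variable {I J : Type*} {n : I → Type*} {m : J → Type*}

/-- Copying the classical index of a state of `⨁ i, B(ℂ^(n i))`: the map
`⨁ i, B(ℂ^(n i)) → ⨁ (i', i), B(ℂ^(n i))` that puts the block `i` at `(i, i)`. -/
def copyIndex [DecidableEq I] : MultiMat n →ₗ[ℂ] MultiMat (fun x : I × I => n x.2) where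
  toFun a := fun x => if x.1 = x.2 then a x.2 else 0
  map_add' a b := by
    funext x
    by_cases h : x.1 = x.2 <;> simp [h]
  map_smul' c a := by
    funext x
    by_cases h : x.1 = x.2 <;> simp [h]

/-- `id ⊗ Φ` on `ℂ^X ⊗ A`: a classical system with index set `X` is left untouched
while `Φ` is applied. -/
def besideClassical (X : Type*) (Φ : MultiMat n →ₗ[ℂ] MultiMat m) :
    MultiMat (fun x : X × I => n x.2) →ₗ[ℂ] MultiMat (fun x : X × J => m x.2) where
  toFun a := fun x => Φ (fun i => a (x.1, i)) x.2
  map_add' a b := by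
    funext x
    exact congrFun (Φ.map_add (fun i => a (x.1, i)) (fun i => b (x.1, i))) x.2
  map_smul' c a := by
    funext x
    exact congrFun (Φ.map_smul c (fun i => a (x.1, i))) x.2

/-- `Φ ⊗ id` on `A ⊗ B(ℂ^P)`: a quantum system with Hilbert space `ℂ^P` is left untouched while
`Φ` is applied. The algebra `A ⊗ B(ℂ^P)` is `⨁ i, B(ℂ^(n i) ⊗ ℂ^P)`. -/
def besideQuantum (P : Type*) (Φ : MultiMat n →ₗ[ℂ] MultiMat m) :
    MultiMat (fun i => n i × P) →ₗ[ℂ] MultiMat (fun j => m j × P) where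
  toFun a := fun j => CStarMatrix.ofMatrix <| Matrix.of fun p q =>
    Φ (fun i => CStarMatrix.ofMatrix <| Matrix.of fun r s => a i (r, p.2) (s, q.2)) j p.1 q.1
  map_add' a b := by
    funext x
    ext p q
    exact congrFun (congrFun (congrFun (Φ.map_add
      (fun i => CStarMatrix.ofMatrix <|
      Matrix.of fun r s => a i (r, p.2) (s, q.2))
      (fun i => CStarMatrix.ofMatrix <|
      Matrix.of fun r s => b i (r, p.2) (s, q.2))) x) p.1) q.1
  map_smul' c a := by
    funext x
    ext p q
    exact congrFun (congrFun (congrFun (Φ.map_smul c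
      (fun i => CStarMatrix.ofMatrix <|
      Matrix.of fun r s => a i (r, p.2) (s, q.2))) x) p.1) q.1

variable {K L : Type*} {hin : I → Type*} {hout : J → Type*} {kin : K → Type*} {kout : L → Type*}
  {P : Type*}

/-- The circuit built from `E : C → A ⊗ B(ℂ^P)`, `F : A → B` and
`G : ⨁ (k, i), B ⊗ B(ℂ^P) → D`. In order: copy `k`; feed one copy and the state to `E`; copy the
outcome `i`; feed one copy and the state of `A` to `F`, leaving `k`, the other copy of `i` and the
ancilla alone; feed everything to `G`. -/
def circuit [DecidableEq I] [DecidableEq K]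
    (E : MultiMat kin →ₗ[ℂ] MultiMat (fun i => hin i × P))
    (F : MultiMat hin →ₗ[ℂ] MultiMat hout)
    (G : MultiMat (fun x : K × (I × J) => hout x.2.2 × P) →ₗ[ℂ] MultiMat kout) :
    MultiMat kin →ₗ[ℂ] MultiMat kout :=
  G ∘ₗ besideClassical K (besideClassical I (besideQuantum P F)) ∘ₗ
    besideClassical K (copyIndex (n := fun i => hin i × P)) ∘ₗ besideClassical K E ∘ₗ copyIndex

end Circuit

end Supermaps

end

namespace Supermaps

/-! ### Complete positivity and Choi matrices -/

section Positivity

variable {I J : Type*} {n : I → Type*} {m : J → Type*}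

theorem sum_sum_comm {X : Type*} [Fintype J] [∀ j, Fintype (m j)] (t : Finset X)
    (f : (j : J) → m j → X → ℂ) :
    (∑ j, ∑ p, ∑ x ∈ t, f j p x) = ∑ x ∈ t, ∑ j, ∑ p, f j p x := by
  simp_rw [Finset.sum_comm (s := t)]

open scoped MatrixOrder in
theorem exists_eq_conjTranspose_mul_self {X : Type*} [Fintype X]
    {M : Matrix X X ℂ} (hM : M.PosSemidef) : ∃ C : Matrix X X ℂ, M = C.conjTranspose * C := by
  classical
  exact CStarAlgebra.nonneg_iff_eq_star_mul_self.mp hM.nonneg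

theorem exists_eq_star_mul_self {A : Type*} [CStarAlgebra A] [PartialOrder A] [StarOrderedRing A]
    {a : A} (ha : 0 ≤ a) : ∃ z, a = star z * z :=
  CStarAlgebra.nonneg_iff_eq_star_mul_self.mp ha

variable [Fintype I] [∀ i, Fintype (n i)] [∀ i, DecidableEq (n i)]
  [Fintype J] [∀ j, Fintype (m j)] [∀ j, DecidableEq (m j)]

/-- In both orders the positive elements are those of the form `star z * z`, and regrouping indices
block by block respects star and product. This reduces the abstract C⋆-order to positive
semidefinite matrices. -/
theorem amplification_nonneg_iff {X : Type*} [Fintype X] [DecidableEq X]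
    (Y : CStarMatrix X X (MultiMat n)) :
    0 ≤ Y ↔ ∀ i, (Matrix.of fun x y : X × n i => Y x.1 y.1 i x.2 y.2).PosSemidef := by
  have key : ∀ (Z : CStarMatrix X X (MultiMat n)) (i : I),
      (Matrix.of fun x y : X × n i => (star Z * Z) x.1 y.1 i x.2 y.2) =
      (Matrix.of fun x y : X × n i => Z x.1 y.1 i x.2 y.2).conjTranspose *
        (Matrix.of fun x y : X × n i => Z x.1 y.1 i x.2 y.2) := by
    intro Z i
    ext x y
    rw [Matrix.of_apply, CStarMatrix.mul_apply, sum_block_apply, Matrix.mul_apply,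
      Fintype.sum_prod_type]
    rfl
  constructor
  · intro h i
    obtain ⟨z, hz⟩ := exists_eq_star_mul_self h
    rw [hz, key]
    exact Matrix.posSemidef_conjTranspose_mul_self _
  · intro h
    choose C hC using fun i => exists_eq_conjTranspose_mul_self (h i)
    let Z : CStarMatrix X X (MultiMat n) := CStarMatrix.ofMatrix <| Matrix.of fun x y i =>
      CStarMatrix.ofMatrix <| Matrix.of fun p q => C i (x, p) (y, q)
    have : Y = star Z * Z := by
      ext x y i p q
      have h1 := congrFun (congrFun (key Z i) (x, p)) (y, q)
      have h2 := congrFun (congrFun (hC i) (x, p)) (y, q)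
      exact h2.trans h1.symm
    rw [this]
    exact star_mul_self_nonneg _

/-- The Choi matrices of a completely positive map are positive semidefinite. -/
theorem choi_posSemidef [DecidableEq I] (Φ : MultiMat n →CP MultiMat m) (j : J) (i : I) :
    (Matrix.of fun p q => choi Φ.toLinearMap (j, i) p q).PosSemidef := by
  classical
  -- The unnormalised maximally entangled projector; the amplification of `Φ` sends it to the Choi
  -- matrix, up to the order of the tensor factors.
  let Y : CStarMatrix (n i) (n i) (MultiMat n) :=
    CStarMatrix.ofMatrix <| Matrix.of fun r s => matrixUnit i r s
  have hY : 0 ≤ Y := by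
    rw [amplification_nonneg_iff]
    intro i'
    by_cases hi : i' = i
    · subst hi
      have : (Matrix.of fun x y : n i' × n i' => Y x.1 y.1 i' x.2 y.2) =
          Matrix.vecMulVec (fun x => if x.1 = x.2 then 1 else 0)
            (star fun x => if x.1 = x.2 then 1 else 0) := by
        ext x y
        simp only [Y, matrixUnit, Matrix.of_apply, CStarMatrix.ofMatrix_apply, Pi.single_eq_same,
          Matrix.single, Matrix.vecMulVec_apply, Pi.star_apply]
        by_cases h1 : x.1 = x.2 <;> by_cases h2 : y.1 = y.2 <;> simp [h1, h2]
      rw [this]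
      exact Matrix.posSemidef_vecMulVec_self_star _
    · have : (Matrix.of fun x y : n i × n i' => Y x.1 y.1 i' x.2 y.2) = 0 := by
        ext x y
        simp [Y, matrixUnit, Pi.single_eq_of_ne hi]
      rw [this]
      exact Matrix.PosSemidef.zero
  have h := (amplification_nonneg_iff _).mp (Φ.map_cstarMatrix_nonneg Y hY) j
  exact h.submatrix (fun p : m j × n i => (p.2, p.1))

/-- A linear map with positive semidefinite Choi matrices is completely positive. -/
def cpOfChoi [DecidableEq I] (M : ChoiAlg n m)
    (hM : ∀ j i, (Matrix.of fun p q => M (j, i) p q).PosSemidef) :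
    MultiMat n →CP MultiMat m where
  toLinearMap := choi.symm M
  map_cstarMatrix_nonneg' k Y hY := by
    rw [amplification_nonneg_iff] at hY ⊢
    intro j
    choose A hA using fun i => exists_eq_conjTranspose_mul_self (hY i)
    choose C hC using fun i => exists_eq_conjTranspose_mul_self (hM j i)
    have hA' : ∀ i (x y : Fin k) (r s : n i),
        Y x y i r s = ∑ t, star (A i t (x, r)) * A i t (y, s) :=
      fun i x y r s => congrFun (congrFun (hA i) (x, r)) (y, s)
    have hC' : ∀ i (p q : m j) (r s : n i),
        M (j, i) (p, r) (q, s) = ∑ v, star (C i v (p, r)) * C i v (q, s) :=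
      fun i p q r s => congrFun (congrFun (hC i) (p, r)) (q, s)
    -- Contracting two Gram matrices over a shared pair of indices gives a Gram matrix again, with
    -- `D i` as its root.
    let D : (i : I) → Matrix ((Fin k × n i) × (m j × n i)) (Fin k × m j) ℂ := fun i =>
      Matrix.of fun t x => ∑ r, A i t.1 (x.1, r) * C i t.2 (x.2, r)
    have : (Matrix.of fun x y : Fin k × m j => (Y.map (choi.symm M)) x.1 y.1 j x.2 y.2) =
        ∑ i, (D i).conjTranspose * D i := by
      ext x y
      have h : (Matrix.of fun x y : Fin k × m j => (Y.map (choi.symm M)) x.1 y.1 j x.2 y.2) x y =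
          ∑ i, ∑ r, ∑ s, Y x.1 y.1 i r s * M (j, i) (x.2, r) (y.2, s) := rfl
      rw [h, Matrix.sum_apply]
      refine Finset.sum_congr rfl fun i _ => ?_
      rw [Matrix.mul_apply, Fintype.sum_prod_type]
      have h2 : ∀ r s, Y x.1 y.1 i r s * M (j, i) (x.2, r) (y.2, s) =
          ∑ t, ∑ v, star (A i t (x.1, r) * C i v (x.2, r)) * (A i t (y.1, s) * C i v (y.2, s)) := by
        intro r s
        rw [hA', hC', Finset.sum_mul_sum]
        refine Finset.sum_congr rfl fun t _ => ?_
        refine Finset.sum_congr rfl fun v _ => ?_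
        rw [star_mul']
        ring
      have h3 : ∀ t v, (D i).conjTranspose x (t, v) * D i (t, v) y = ∑ r, ∑ s,
          star (A i t (x.1, r) * C i v (x.2, r)) * (A i t (y.1, s) * C i v (y.2, s)) := by
        intro t v
        simp only [D, Matrix.conjTranspose_apply, Matrix.of_apply, star_sum]
        rw [Finset.sum_mul_sum]
      simp_rw [h2, h3]
      rw [sum_sum_comm (J := n i) (m := fun _ => n i)]
      refine Finset.sum_congr rfl fun t _ => ?_
      rw [sum_sum_comm (J := n i) (m := fun _ => n i)]
    rw [this]
    exact Matrix.posSemidef_sum _ fun i _ => Matrix.posSemidef_conjTranspose_mul_self _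

/-- The channel with a given positive Choi operator obeying (TP). -/
def channelOfChoi [DecidableEq I] (M : ChoiAlg n m)
    (hM : ∀ j i, (Matrix.of fun p q => M (j, i) p q).PosSemidef)
    (hTP : ∀ i r s, ∑ j, ∑ p, M (j, i) (p, r) (p, s) = if r = s then 1 else 0) :
    Channel n m where
  toCompletelyPositiveMap := cpOfChoi M hM
  trace_map a := by
    have : (choi.symm M a).trace = a.trace := by
      have h1 : (choi.symm M a).trace =
          ∑ j, ∑ p, ∑ i, ∑ r, ∑ s, a i r s * M (j, i) (p, r) (p, s) := rfl
      rw [h1]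
      have h2 : ∀ i r s, ∑ j, ∑ p, a i r s * M (j, i) (p, r) (p, s) =
          if r = s then a i r s else 0 := by
        intro i r s
        simp_rw [← Finset.mul_sum]
        rw [hTP]
        simp
      have h3 : a.trace = ∑ i, ∑ r, ∑ s, ∑ j, ∑ p, a i r s * M (j, i) (p, r) (p, s) := by
        simp_rw [h2]
        simp [MultiMat.trace]
      rw [h3]
      rw [sum_sum_comm]
      refine Finset.sum_congr rfl fun i _ => ?_
      rw [sum_sum_comm]
      refine Finset.sum_congr rfl fun r _ => ?_
      rw [sum_sum_comm]
    exact this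

end Positivity

/-! ### The output trace and the marginal of a supermap -/

section Marginal

variable {I J K L : Type*} {n : I → Type*} {m : J → Type*}

/-- The partial trace over the output system, `Hom(A, B) → ⨁ i, B((ℂ^(n i))^*)`. -/
def outTrace [Fintype J] [∀ j, Fintype (m j)] : ChoiAlg n m →ₗ[ℂ] MultiMat n where
  toFun X := fun i => CStarMatrix.ofMatrix (Matrix.of fun r s => ∑ j, ∑ p, X (j, i) (p, r) (p, s))
  map_add' X Y := by
    ext i r s
    simp [Finset.sum_add_distrib]
  map_smul' c X := by
    ext i r s
    simp [Finset.mul_sum]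

theorem outTrace_apply [Fintype J] [∀ j, Fintype (m j)] (X : ChoiAlg n m) (i : I) (r s : n i) :
    outTrace X i r s = ∑ j, ∑ p, X (j, i) (p, r) (p, s) := rfl

theorem outTrace_star [Fintype J] [∀ j, Fintype (m j)] (X : ChoiAlg n m) :
    outTrace (star X) = star (outTrace X) := by
  ext i r s
  have h : star (outTrace X) i r s = star (∑ j, ∑ p, X (j, i) (p, s) (p, r)) := rfl
  rw [h, star_sum]
  simp_rw [star_sum]
  rfl

theorem one_block_apply [∀ i, DecidableEq (n i)] (i : I) (r s : n i) :
    (1 : MultiMat n) i r s = if r = s then 1 else 0 := CStarMatrix.one_apply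

theorem isTP_iff [Fintype J] [∀ j, Fintype (m j)] [∀ i, DecidableEq (n i)] (X : ChoiAlg n m) :
    X.IsTP ↔ outTrace X = 1 :=
  ⟨fun h => funext h, fun h i => congrFun h i⟩

theorem outTrace_matrixUnit [Fintype J] [∀ j, Fintype (m j)] [DecidableEq I] [DecidableEq J]
    [∀ i, DecidableEq (n i)] [∀ j, DecidableEq (m j)] (j : J) (i : I) (p q : m j) (r s : n i) :
    outTrace (matrixUnit (n := ChoiIndex n m) (j, i) (p, r) (q, s)) =
      if p = q then matrixUnit i r s else 0 := by
  ext i' r' s'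
  rw [outTrace_apply, Finset.sum_eq_single j]
  · by_cases hi : i' = i
    · subst hi
      split_ifs with h
      · subst h
        by_cases h1 : r = r' <;> by_cases h2 : s = s' <;>
          simp [matrixUnit, Matrix.single_apply, h1, h2]
      · simp [matrixUnit, Matrix.single_apply]
        grind
    · have : (j, i') ≠ (j, i) := by simpa using hi
      split_ifs <;> simp [matrixUnit, Pi.single_eq_of_ne hi, Pi.single_eq_of_ne this]
  · intro j' _ hj
    have : (j', i') ≠ (j, i) := fun h => hj (congrArg Prod.fst h)
    simp [matrixUnit, Pi.single_eq_of_ne this]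
  · simp

theorem outTrace_one [Fintype J] [∀ j, Fintype (m j)] [∀ i, DecidableEq (n i)]
    [∀ j, DecidableEq (m j)] :
    outTrace (1 : ChoiAlg n m) = ((∑ j, Fintype.card (m j) : ℕ) : ℂ) • 1 := by
  ext i r s
  have h : ∀ j p, (1 : ChoiAlg n m) (j, i) (p, r) (p, s) = if r = s then 1 else 0 := by
    intro j p
    exact (one_block_apply (n := ChoiIndex n m) (j, i) (p, r) (p, s)).trans (by simp)
  rw [outTrace_apply]
  simp_rw [h]
  rw [Pi.smul_apply, CStarMatrix.smul_apply, one_block_apply]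
  simp

theorem self_add_smul_one_nonneg {A : Type*} [CStarAlgebra A] [PartialOrder A] [StarOrderedRing A]
    {a : A} (ha : IsSelfAdjoint a) {t : ℝ} (ht : ‖a‖ ≤ t) : 0 ≤ a + (t : ℂ) • (1 : A) := by
  have h1 := ha.neg_algebraMap_norm_le_self
  have h2 : algebraMap ℝ A ‖a‖ ≤ algebraMap ℝ A t := algebraMap_mono A ht
  have h3 : (t : ℂ) • (1 : A) = algebraMap ℝ A t := by
    rw [Algebra.algebraMap_eq_smul_one]
    exact (RCLike.real_smul_eq_coe_smul (K := ℂ) t (1 : A)).symm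
  rw [h3]
  calc (0 : A) ≤ a + algebraMap ℝ A ‖a‖ := by simpa using neg_le_iff_add_nonneg.mp h1
    _ ≤ _ := by gcongr

theorem smul_nonneg_of_nonneg {A : Type*} [CStarAlgebra A] [PartialOrder A] [StarOrderedRing A]
    {a : A} (ha : 0 ≤ a) {t : ℝ} (ht : 0 ≤ t) : 0 ≤ (t : ℂ) • a := by
  have : (0 : ℂ) ≤ (t : ℂ) := by exact_mod_cast ht
  exact smul_nonneg this ha

variable {hin : I → Type*} {hout : J → Type*} {kin : K → Type*} {kout : L → Type*}
  [Fintype I] [Fintype J] [Fintype K] [Fintype L]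
  [∀ i, Fintype (hin i)] [∀ j, Fintype (hout j)] [∀ k, Fintype (kin k)] [∀ l, Fintype (kout l)]
  [∀ i, DecidableEq (hin i)] [∀ j, DecidableEq (hout j)] [∀ k, DecidableEq (kin k)]
  [∀ l, DecidableEq (kout l)]

namespace DeterministicSupermap

variable (S : DeterministicSupermap hin hout kin kout)

theorem outTrace_map_eq_one_of_nonneg {X : ChoiAlg hin hout} (hX : 0 ≤ X) (h : outTrace X = 1) :
    outTrace (S.toLinearMap X) = 1 :=
  (isTP_iff _).mp (S.map_tp X hX ((isTP_iff X).mpr h)).2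

/-- The maximally mixed element obeys (TP). -/
theorem outTrace_map_smul_one {j : J} (p : hout j) :
    outTrace (S.toLinearMap (((((∑ j, Fintype.card (hout j) : ℕ) : ℝ)⁻¹ : ℝ) : ℂ) •
      (1 : ChoiAlg hin hout))) = 1 := by
  have hd : (∑ j, Fintype.card (hout j)) ≠ 0 := fun h => by
    have := Finset.sum_eq_zero_iff.mp h j (Finset.mem_univ j)
    exact (Fintype.card_eq_zero_iff.mp this).false p
  apply S.outTrace_map_eq_one_of_nonneg
  · exact smul_nonneg_of_nonneg zero_le_one (by positivity)
  · rw [map_smul, outTrace_one, smul_smul]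
    have hd' : ((∑ j, Fintype.card (hout j) : ℕ) : ℂ) ≠ 0 := by exact_mod_cast hd
    rw [Complex.ofReal_inv, Complex.ofReal_natCast, inv_mul_cancel₀ hd', one_smul]

/-- The maximally mixed element is interior to the positive cone, so adding a small multiple of `X`
keeps it positive and (TP). Both elements have image of output trace `1`; subtracting leaves a
nonzero multiple of the claim. -/
theorem outTrace_map_eq_zero_of_isSelfAdjoint {X : ChoiAlg hin hout} (hX : IsSelfAdjoint X)
    (h : outTrace X = 0) {j : J} (p : hout j) : outTrace (S.toLinearMap X) = 0 := by
  set d : ℝ := ((∑ j, Fintype.card (hout j) : ℕ) : ℝ) with hd_def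
  have hd : 0 < d := by
    have : 0 < ∑ j, Fintype.card (hout j) :=
      Finset.sum_pos' (fun _ _ => Nat.zero_le _)
        ⟨j, Finset.mem_univ j, Fintype.card_pos_iff.mpr ⟨p⟩⟩
    rw [hd_def]
    exact_mod_cast this
  have h0 := S.outTrace_map_smul_one p
  -- The norm makes `X + t` positive; the extra `1` keeps `t` invertible when `X = 0`.
  set t : ℝ := ‖X‖ + 1 with ht_def
  have ht : 0 < t := by positivity
  have htd : 0 < d⁻¹ * t⁻¹ := by positivity
  have hY : ((d⁻¹ * t⁻¹ : ℝ) : ℂ) • (X + (t : ℂ) • (1 : ChoiAlg hin hout)) =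
      ((d⁻¹ * t⁻¹ : ℝ) : ℂ) • X + ((d⁻¹ : ℝ) : ℂ) • (1 : ChoiAlg hin hout) := by
    rw [smul_add, smul_smul]
    congr 2
    have : (t : ℂ) ≠ 0 := by exact_mod_cast ht.ne'
    push_cast
    field_simp
  have h1 : outTrace (S.toLinearMap (((d⁻¹ * t⁻¹ : ℝ) : ℂ) • X +
      ((d⁻¹ : ℝ) : ℂ) • (1 : ChoiAlg hin hout))) = 1 := by
    apply S.outTrace_map_eq_one_of_nonneg
    · rw [← hY]
      exact smul_nonneg_of_nonneg (self_add_smul_one_nonneg hX (by linarith)) htd.le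
    · rw [map_add, map_smul, h, smul_zero, zero_add, map_smul, outTrace_one, smul_smul]
      have hd' : ((∑ j, Fintype.card (hout j) : ℕ) : ℂ) = (d : ℂ) := by rw [hd_def]; simp
      have hd2 : (d : ℂ) ≠ 0 := by exact_mod_cast hd.ne'
      rw [hd', Complex.ofReal_inv, inv_mul_cancel₀ hd2, one_smul]
  rw [map_add, map_add, h0, map_smul, map_smul, add_eq_right] at h1
  exact (smul_eq_zero.mp h1).resolve_left (by exact_mod_cast htd.ne')

/-- Split into real and imaginary parts; both inherit a vanishing output trace. -/
theorem outTrace_map_eq_zero {X : ChoiAlg hin hout}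
    (h : outTrace X = 0) {j : J} (p : hout j) : outTrace (S.toLinearMap X) = 0 := by
  have h1 : outTrace (S.toLinearMap (X + star X)) = 0 := by
    refine S.outTrace_map_eq_zero_of_isSelfAdjoint ?_ ?_ p
    · exact IsSelfAdjoint.add_star_self X
    · rw [map_add, outTrace_star, h, star_zero, add_zero]
  have h2 : outTrace (S.toLinearMap (Complex.I • (X - star X))) = 0 := by
    refine S.outTrace_map_eq_zero_of_isSelfAdjoint ?_ ?_ p
    · rw [IsSelfAdjoint, star_smul, star_sub, star_star, Complex.star_def, Complex.conj_I,
        neg_smul, ← smul_neg, neg_sub]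
    · rw [map_smul, map_sub, outTrace_star, h, star_zero, sub_zero, smul_zero]
  have h3 : (2 : ℂ) • X = (X + star X) + (-Complex.I) • (Complex.I • (X - star X)) := by
    rw [smul_smul, neg_mul, Complex.I_mul_I, neg_neg, one_smul, two_smul]
    abel
  have h4 : (2 : ℂ) • outTrace (S.toLinearMap X) = 0 := by
    rw [← map_smul, ← map_smul, h3, map_add, map_add, h1, map_smul, map_smul, h2, smul_zero,
      add_zero]
  exact (smul_eq_zero.mp h4).resolve_left two_ne_zero

theorem outTrace_map_eq {X Y : ChoiAlg hin hout}
    (h : outTrace X = outTrace Y) {j : J} (p : hout j) :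
    outTrace (S.toLinearMap X) = outTrace (S.toLinearMap Y) := by
  rw [← sub_eq_zero, ← map_sub, ← map_sub]
  exact S.outTrace_map_eq_zero (by rw [map_sub, h, sub_self]) p

theorem outTrace_map_eq_one {X : ChoiAlg hin hout}
    (h : outTrace X = 1) {j : J} (p : hout j) : outTrace (S.toLinearMap X) = 1 := by
  have hd : (∑ j, Fintype.card (hout j)) ≠ 0 := fun h => by
    have := Finset.sum_eq_zero_iff.mp h j (Finset.mem_univ j)
    exact (Fintype.card_eq_zero_iff.mp this).false p
  rw [← S.outTrace_map_smul_one p]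
  refine S.outTrace_map_eq ?_ p
  rw [h, map_smul, outTrace_one, smul_smul]
  have hd' : ((∑ j, Fintype.card (hout j) : ℕ) : ℂ) ≠ 0 := by exact_mod_cast hd
  rw [Complex.ofReal_inv, Complex.ofReal_natCast, inv_mul_cancel₀ hd', one_smul]

/-- The output is nonzero as soon as the input systems `B` and `C` are. -/
theorem exists_output (S : DeterministicSupermap hin hout kin kout) {j : J} (p : hout j)
    {k : K} (s : kin k) : ∃ l, Nonempty (kout l) := by
  by_contra! hl
  have h := congrFun (congrFun (congrFun (S.outTrace_map_smul_one p) k) s) s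
  rw [outTrace_apply, one_block_apply, if_pos rfl] at h
  simp at h

end DeterministicSupermap

theorem sum_indicator {X : Type*} [Fintype X] {f : X → Type*} [∀ x, Fintype (f x)]
    [DecidableEq ((x : X) × f x)] (y : (x : X) × f x) :
    ∑ x, ∑ r, (if (⟨x, r⟩ : (x : X) × f x) = y then (1 : ℂ) else 0) = 1 := by
  rw [← Fintype.sum_sigma' (f := fun x r => if (⟨x, r⟩ : (x : X) × f x) = y then (1 : ℂ) else 0)]
  simp

namespace DeterministicSupermap

variable [DecidableEq I] [DecidableEq J] (S : DeterministicSupermap hin hout kin kout)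

/-- The Choi matrices of the map `⨁ i, B((ℂ^(hin i))^*) → ⨁ k, B((ℂ^(kin k))^*)` through which a
deterministic supermap acts on output-traced Choi operators. -/
theorem exists_marginal :
    ∃ N : (k : K) → (i : I) → Matrix (kin k × hin i) (kin k × hin i) ℂ,
      (∀ k i, (N k i).PosSemidef) ∧
      (∀ k s s', ∑ i, ∑ r, N k i (s, r) (s', r) = if s = s' then 1 else 0) ∧
      ∀ k i j h h' s s' r r',
        ∑ l, ∑ q, choi S.toLinearMap ((l, k), (j, i)) ((q, s), (h, r)) ((q, s'), (h', r')) =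
          if h = h' then N k i (s, r) (s', r') else 0 := by
  classical
  have hM : ∀ k i j h h' s s' r r',
      ∑ l, ∑ q, choi S.toLinearMap ((l, k), (j, i)) ((q, s), (h, r)) ((q, s'), (h', r')) =
      outTrace (S.toLinearMap (matrixUnit (n := ChoiIndex hin hout) (j, i) (h, r) (h', r')))
        k s s' := fun _ _ _ _ _ _ _ _ _ => rfl
  by_cases hne : ∃ j, Nonempty (hout j)
  · obtain ⟨j₀, ⟨p₀⟩⟩ := hne
    -- Any diagonal unit of `B` gives the same marginal, so `N` is read off at a fixed basis vector
    -- `p₀`.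
    refine ⟨fun k i => Matrix.of fun x y => ∑ l, ∑ q,
      choi S.toLinearMap ((l, k), (j₀, i)) ((q, x.1), (p₀, x.2)) ((q, y.1), (p₀, y.2)),
      ?_, ?_, ?_⟩
    · intro k i
      have : (Matrix.of fun x y : kin k × hin i => ∑ l, ∑ q,
          choi S.toLinearMap ((l, k), (j₀, i)) ((q, x.1), (p₀, x.2)) ((q, y.1), (p₀, y.2))) =
          ∑ l, ∑ q, (Matrix.of fun x y => choi S.toLinearMap ((l, k), (j₀, i)) x y).submatrix
            (fun x : kin k × hin i => ((q, x.1), (p₀, x.2))) (fun x => ((q, x.1), (p₀, x.2))) := by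
        ext x y
        simp only [Matrix.sum_apply]
        rfl
      refine Eq.subst (motive := Matrix.PosSemidef) this.symm ?_
      exact Matrix.posSemidef_sum _ fun l _ => Matrix.posSemidef_sum _ fun q _ =>
        (choi_posSemidef S.toCompletelyPositiveMap (l, k) (j₀, i)).submatrix _
    · intro k s s'
      simp only [Matrix.of_apply, hM]
      -- The element `|p₀⟩⟨p₀| ⊗ 1` obeys (TP), whence `N` is unital.
      have : ∑ i, ∑ r, outTrace (matrixUnit (n := ChoiIndex hin hout) (j₀, i) (p₀, r) (p₀, r)) =
          1 := by
        have h1 : ∀ i (r s : hin i), (1 : MultiMat hin) i r s • matrixUnit (n := hin) i r s =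
            if r = s then matrixUnit i r s else 0 := by
          intro i r s
          rw [one_block_apply]
          split_ifs <;> simp
        simp_rw [outTrace_matrixUnit, if_pos]
        conv_rhs => rw [← sum_matrixUnit (1 : MultiMat hin)]
        simp_rw [h1]
        simp
      simp_rw [← map_sum] at this
      have h2 := congrFun (congrFun (congrFun (S.outTrace_map_eq_one this p₀) k) s) s'
      simp_rw [map_sum, one_block_apply, sum_block_apply] at h2
      exact h2
    · intro k i j h h' s s' r r'
      rw [hM]
      split_ifs with hh
      · subst hh
        simp only [Matrix.of_apply, hM]
        exact congrFun (congrFun (congrFun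
          (S.outTrace_map_eq (by rw [outTrace_matrixUnit, outTrace_matrixUnit, if_pos rfl,
            if_pos rfl]) p₀) k) s) s'
      · rw [S.outTrace_map_eq_zero (by simp_rw [outTrace_matrixUnit, if_neg hh]) p₀]
        rfl
  -- Here `B = 0` and the third condition is vacuous. If `A` is nonzero, any unital choice of `N`
  -- serves; the one below makes the encoder discard its input and prepare the basis state `r₀`.
  · have hemp : ∀ j, IsEmpty (hout j) := by simpa using hne
    by_cases hA : ∃ i, Nonempty (hin i)
    · obtain ⟨i₀, ⟨r₀⟩⟩ := hA
      refine ⟨fun k i => Matrix.diagonal fun x =>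
        if (⟨i, x.2⟩ : (i : I) × hin i) = ⟨i₀, r₀⟩ then 1 else 0, ?_, ?_, ?_⟩
      · intro k i
        refine Matrix.PosSemidef.diagonal fun x => ?_
        dsimp only
        split_ifs
        · exact zero_le_one
        · exact le_rfl
      · intro k s s'
        split_ifs with h
        · subst h
          simp only [Matrix.diagonal_apply_eq]
          exact sum_indicator _
        · simp [h]
      · intro k i j h
        exact ((hemp j).false h).elim
    · have hemp' : ∀ i, IsEmpty (hin i) := by simpa using hA
      refine ⟨fun k i => 0, fun k i => Matrix.PosSemidef.zero, ?_, ?_⟩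
      · intro k s s'
        -- With `A = B = 0` the element `0` obeys (TP), so `0 = 1` in `C`, and `N = 0` is unital.
        have h := S.outTrace_map_eq_one_of_nonneg (X := 0) le_rfl
          (by ext i r; exact ((hemp' i).false r).elim)
        have h2 := congrFun (congrFun (congrFun h k) s) s'
        rw [one_block_apply, map_zero, map_zero] at h2
        simp only [Matrix.zero_apply, Finset.sum_const_zero]
        exact h2
      · intro k i j h
        exact ((hemp j).false h).elim

end DeterministicSupermap

end Marginal

/-! ### Factorization and supports of positive matrices -/

section Factorization

open scoped Kronecker
open Matrix

/-- A positive semidefinite matrix `N` on `X` has a factorization `N = W Wᴴ` through any `Y` with at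
least as many elements, together with a pseudo-inverse `Q` of `W`. -/
theorem exists_factorization {X Y : Type*} [Fintype X] [DecidableEq X] [Fintype Y] [DecidableEq Y]
    {N : Matrix X X ℂ} (hN : N.PosSemidef) (hXY : Fintype.card X ≤ Fintype.card Y) :
    ∃ (W : Matrix X Y ℂ) (Q : Matrix Y X ℂ), W * Wᴴ = N ∧ W * Q * N = N ∧
      (1 - Q * N * Qᴴ).PosSemidef := by
  obtain ⟨e⟩ := Function.Embedding.nonempty_of_card_le hXY
  -- The coisometry that pads the space of `N` to `Y`.
  let E : Matrix X Y ℂ := Matrix.of fun x y => if e x = y then 1 else 0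
  have hE : E * Eᴴ = 1 := by
    ext x x'
    rw [Matrix.mul_apply, Matrix.one_apply]
    simp [E, e.injective.eq_iff, eq_comm]
  let U : Matrix X X ℂ := hN.isHermitian.eigenvectorUnitary
  have hU : Uᴴ * U = 1 := Unitary.coe_star_mul_self hN.isHermitian.eigenvectorUnitary
  let d : X → ℂ := fun x => (Real.sqrt (hN.isHermitian.eigenvalues x) : ℂ)
  have hd : ∀ x, star (d x) = d x := fun x => Complex.conj_ofReal _
  have hD : (diagonal d)ᴴ = diagonal d := by
    rw [diagonal_conjTranspose]
    congr 1
    exact funext hd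
  have hD' : (diagonal d⁻¹)ᴴ = diagonal d⁻¹ := by
    rw [diagonal_conjTranspose]
    congr 1
    funext x
    simp [hd]
  have hspec : N = U * (diagonal d * diagonal d) * Uᴴ := by
    rw [diagonal_mul_diagonal]
    have h := hN.isHermitian.spectral_theorem
    rw [Unitary.conjStarAlgAut_apply] at h
    have h2 : (fun x => d x * d x) = RCLike.ofReal ∘ hN.isHermitian.eigenvalues := by
      funext x
      simp only [d, Function.comp]
      rw [← Complex.ofReal_mul, Real.mul_self_sqrt (hN.eigenvalues_nonneg x)]
      rfl
    rw [h2]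
    exact h
  -- Since `0⁻¹ = 0`, `diagonal d⁻¹` is the pseudo-inverse of `diagonal d`, and `δ` projects onto
  -- the nonzero eigenvalues.
  let δ : Matrix X X ℂ := diagonal d⁻¹ * diagonal d
  have hδ : δ * δ = δ := by
    simp only [δ, diagonal_mul_diagonal]
    congr 1
    funext x
    by_cases h : d x = 0 <;> simp [h]
  have hδ' : δᴴ = δ := by
    simp only [δ, diagonal_mul_diagonal, diagonal_conjTranspose]
    congr 1
    funext x
    simp [hd]
  have hdd : diagonal d * diagonal d⁻¹ * diagonal d = diagonal d := by
    simp only [diagonal_mul_diagonal]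
    congr 1
    funext x
    by_cases h : d x = 0 <;> simp [h]
  refine ⟨U * diagonal d * E, Eᴴ * diagonal d⁻¹ * Uᴴ, ?_, ?_, ?_⟩
  · calc U * diagonal d * E * (U * diagonal d * E)ᴴ
        = U * diagonal d * (E * Eᴴ) * (diagonal d)ᴴ * Uᴴ := by
          simp only [conjTranspose_mul, Matrix.mul_assoc]
      _ = N := by rw [hE, hD, Matrix.mul_one, hspec, Matrix.mul_assoc U]
  · calc U * diagonal d * E * (Eᴴ * diagonal d⁻¹ * Uᴴ) * N
        = U * diagonal d * (E * Eᴴ) * diagonal d⁻¹ * (Uᴴ * U) * (diagonal d * diagonal d) * Uᴴ := by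
          rw [hspec]
          simp only [Matrix.mul_assoc]
      _ = U * (diagonal d * diagonal d⁻¹ * diagonal d) * diagonal d * Uᴴ := by
          rw [hE, hU]
          simp only [Matrix.mul_assoc, Matrix.mul_one]
      _ = N := by rw [hdd, hspec, ← Matrix.mul_assoc U]
  · have h1 : Eᴴ * diagonal d⁻¹ * Uᴴ * N * (Eᴴ * diagonal d⁻¹ * Uᴴ)ᴴ = Eᴴ * δ * E := by
      calc _ = Eᴴ * diagonal d⁻¹ * (Uᴴ * U) * diagonal d * diagonal d * (Uᴴ * U) *
            (diagonal d⁻¹)ᴴ * E := by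
            conv_lhs => rw [hspec]
            simp only [conjTranspose_mul, conjTranspose_conjTranspose, Matrix.mul_assoc]
        _ = Eᴴ * (δ * δᴴ) * E := by
            rw [hU, hD']
            simp only [δ, conjTranspose_mul, hD, hD', Matrix.mul_assoc, Matrix.mul_one]
        _ = _ := by rw [hδ', hδ]
    rw [h1]
    -- `Eᴴ δ E` is an orthogonal projection, hence so is its complement.
    have h2 : (1 - Eᴴ * δ * E) = (1 - Eᴴ * δ * E)ᴴ * (1 - Eᴴ * δ * E) := by
      have h3 : (Eᴴ * δ * E)ᴴ = Eᴴ * δ * E := by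
        simp only [conjTranspose_mul, conjTranspose_conjTranspose, hδ', Matrix.mul_assoc]
      have h4 : (Eᴴ * δ * E) * (Eᴴ * δ * E) = Eᴴ * δ * E := by
        calc _ = Eᴴ * δ * (E * Eᴴ) * δ * E := by simp only [Matrix.mul_assoc]
          _ = Eᴴ * (δ * δ) * E := by rw [hE, Matrix.mul_one, Matrix.mul_assoc Eᴴ]
          _ = _ := by rw [hδ]
      rw [conjTranspose_sub, conjTranspose_one, h3, Matrix.sub_mul, Matrix.one_mul,
        Matrix.mul_sub, h4, Matrix.mul_one]
      simp
    rw [h2]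
    exact posSemidef_conjTranspose_mul_self _

theorem one_kronecker_conj_apply {X Y Z : Type*} [Fintype X] [Fintype Z] [DecidableEq Z]
    (Q : Matrix Y X ℂ) (M : Matrix (Z × X) (Z × X) ℂ) (z z' : Z) (b b' : Y) :
    (((1 : Matrix Z Z ℂ) ⊗ₖ Q) * M * ((1 : Matrix Z Z ℂ) ⊗ₖ Q)ᴴ) (z, b) (z', b') =
      (Q * (Matrix.of fun x x' => M (z, x) (z', x')) * Qᴴ) b b' := by
  simp only [Matrix.mul_apply, conjTranspose_apply, kroneckerMap_apply, Fintype.sum_prod_type,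
    Matrix.one_apply, Matrix.of_apply]
  have h : ∀ (x : Z) (y : X), star ((if z' = x then 1 else 0) * Q b' y) =
      if z' = x then star (Q b' y) else 0 := by
    intro x y
    split_ifs <;> simp
  simp_rw [h]
  simp [ite_mul]

/-- If the diagonal blocks of `M` are dominated by `N`, then `M` is supported on `Z ⊗ supp N`. -/
theorem kronecker_mul_eq_self {X Z : Type*} [Fintype X] [DecidableEq X] [Fintype Z] [DecidableEq Z]
    {M : Matrix (Z × X) (Z × X) ℂ} (hM : M.PosSemidef) {N : Matrix X X ℂ}
    (hN : ∀ z, (N - Matrix.of fun x x' => M (z, x) (z, x')).PosSemidef)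
    {P : Matrix X X ℂ} (hNh : Nᴴ = N) (hP : P * N = N) :
    ((1 : Matrix Z Z ℂ) ⊗ₖ P) * M = M := by
  -- For `v` in the kernel of `N`, domination forces the quadratic form of `M` to vanish at `e_z ⊗
  -- v`; positivity of `M` then puts this vector in its kernel.
  have key : ∀ (z : Z) (v : X → ℂ), N *ᵥ v = 0 →
      M *ᵥ (fun y => if y.1 = z then v y.2 else 0) = 0 := by
    intro z v hv
    rw [← hM.dotProduct_mulVec_zero_iff]
    have h1 := (hN z).dotProduct_mulVec_nonneg v
    rw [sub_mulVec, hv, zero_sub, dotProduct_neg, Left.nonneg_neg_iff] at h1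
    refine le_antisymm (le_of_eq_of_le ?_ h1) (hM.dotProduct_mulVec_nonneg _)
    simp only [dotProduct, mulVec, Fintype.sum_prod_type, Pi.star_apply, Matrix.of_apply]
    rw [Finset.sum_eq_single z]
    · refine Finset.sum_congr rfl fun x _ => ?_
      rw [if_pos rfl]
      congr 1
      rw [Finset.sum_eq_single z]
      · simp
      · intro z' _ hz
        simp [hz]
      · simp
    · intro z' _ hz
      simp [hz]
    · simp
  -- The columns of `(1 - P)ᴴ` lie in the kernel of `N`, because `(1 - P) N = 0` and `N` is
  -- Hermitian.
  have h2 : M * ((1 : Matrix Z Z ℂ) ⊗ₖ (1 - P))ᴴ = 0 := by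
    ext a ⟨z, x⟩
    have hv : N *ᵥ (fun x' => star ((1 - P) x x')) = 0 := by
      have h3 : N * (1 - P)ᴴ = 0 := by
        have : ((1 - P) * N)ᴴ = 0 := by
          rw [Matrix.sub_mul, hP, Matrix.one_mul, sub_self, conjTranspose_zero]
        rwa [conjTranspose_mul, hNh] at this
      funext x'
      exact congrFun (congrFun h3 x') x
    have h4 := congrFun (key z _ hv) a
    rw [Matrix.zero_apply]
    refine Eq.trans ?_ h4
    rw [Matrix.mul_apply, mulVec, dotProduct]
    refine Finset.sum_congr rfl fun y _ => ?_
    rw [conjTranspose_apply, kroneckerMap_apply, Matrix.one_apply]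
    by_cases h : z = y.1
    · simp [h]
    · simp [h, Ne.symm h]
  have h5 : ((1 : Matrix Z Z ℂ) ⊗ₖ (1 - P)) * M = 0 := by
    have := congrArg conjTranspose h2
    rwa [conjTranspose_mul, conjTranspose_conjTranspose, hM.isHermitian.eq,
      conjTranspose_zero] at this
  have h6 : (1 : Matrix Z Z ℂ) ⊗ₖ (1 - P) = 1 - (1 : Matrix Z Z ℂ) ⊗ₖ P := by
    rw [eq_sub_iff_add_eq, ← kronecker_add, sub_add_cancel, one_kronecker_one]
  rw [h6, Matrix.sub_mul, Matrix.one_mul, sub_eq_zero] at h5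
  exact h5.symm

end Factorization

/-! ### Circuits in terms of Choi operators -/

section Realization

open scoped Kronecker

variable {I J K L : Type*} {hin : I → Type*} {hout : J → Type*} {kin : K → Type*} {kout : L → Type*}
  [Fintype I] [Fintype J] [Fintype K] [Fintype L]
  [∀ i, Fintype (hin i)] [∀ j, Fintype (hout j)] [∀ k, Fintype (kin k)] [∀ l, Fintype (kout l)]
  [∀ i, DecidableEq (hin i)] [∀ j, DecidableEq (hout j)] [∀ k, DecidableEq (kin k)]
  [∀ l, DecidableEq (kout l)]

theorem choi_symm_apply {I J : Type*} {n : I → Type*} {m : J → Type*} [Fintype I] [DecidableEq I]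
    [∀ i, Fintype (n i)] [∀ i, DecidableEq (n i)] (X : ChoiAlg n m) (a : MultiMat n) (j : J)
    (p q : m j) :
    choi.symm X a j p q = ∑ i, ∑ r, ∑ s, a i r s * X (j, i) (p, r) (q, s) := rfl

/-- The matrix elements of a circuit, in terms of the Choi operators of its constituents. -/
theorem circuit_apply {P : Type*} [Fintype P] [DecidableEq P] [DecidableEq I] [DecidableEq J]
    [DecidableEq K]
    (E : ChoiAlg kin (fun i => hin i × P)) (F : ChoiAlg hin hout)
    (G : ChoiAlg (fun x : K × (I × J) => hout x.2.2 × P) kout)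
    (ρ : MultiMat kin) (l : L) (q q' : kout l) :
    circuit (choi.symm E) (choi.symm F) (choi.symm G) ρ l q q' =
      ∑ k, ∑ i, ∑ j, ∑ h, ∑ b, ∑ h', ∑ b',
        (∑ r, ∑ r', (∑ s, ∑ s', ρ k s s' * E (i, k) ((r, b), s) ((r', b'), s')) *
          F (j, i) (h, r) (h', r')) * G (l, (k, (i, j))) (q, (h, b)) (q', (h', b')) := by
  have hE : ∀ k i x x', choi.symm E (fun k' => if k = k' then ρ k' else 0) i x x' =
      ∑ s, ∑ s', ρ k s s' * E (i, k) (x, s) (x', s') := by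
    intro k i x x'
    rw [choi_symm_apply, Finset.sum_eq_single k]
    · simp
    · intro k' _ hk
      simp [hk.symm]
    · simp
  have hF : ∀ (a : MultiMat (fun i => hin i × P)) i j h b h' b',
      choi.symm F (fun i' => CStarMatrix.ofMatrix <| Matrix.of fun r r' =>
        (if i = i' then a i' else 0) (r, b) (r', b')) j h h' =
      ∑ r, ∑ r', a i (r, b) (r', b') * F (j, i) (h, r) (h', r') := by
    intro a i j h b h' b'
    rw [choi_symm_apply, Finset.sum_eq_single i]
    · simp
    · intro i' _ hi
      simp [hi.symm]
    · simp
  have hc : circuit (choi.symm E) (choi.symm F) (choi.symm G) ρ l q q' =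
      ∑ x : K × (I × J), ∑ y, ∑ y',
        (choi.symm F (fun i' => CStarMatrix.ofMatrix <| Matrix.of fun r r' =>
          (if x.2.1 = i' then choi.symm E (fun k' => if x.1 = k' then ρ k' else 0) i' else 0)
            (r, y.2) (r', y'.2)) x.2.2 y.1 y'.1) * G (l, x) (q, y) (q', y') := rfl
  rw [hc]
  simp_rw [hF, hE, Fintype.sum_prod_type]

theorem choi_onChannel_apply [DecidableEq I] [DecidableEq J] [DecidableEq K]
    (S : DeterministicSupermap hin hout kin kout)
    (F : Channel hin hout) (ρ : MultiMat kin) (l : L) (q q' : kout l) :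
    S.onChannel F ρ l q q' = ∑ k, ∑ s, ∑ s', ρ k s s' * ∑ i, ∑ j, ∑ h, ∑ h', ∑ r, ∑ r',
      choi F.toLinearMap (j, i) (h, r) (h', r') *
        choi S.toLinearMap ((l, k), (j, i)) ((q, s), (h, r)) ((q', s'), (h', r')) := by
  have hS : ∀ k s s', S.toLinearMap (choi F.toLinearMap) (l, k) (q, s) (q', s') =
      ∑ i, ∑ j, ∑ h, ∑ h', ∑ r, ∑ r', choi F.toLinearMap (j, i) (h, r) (h', r') *
        choi S.toLinearMap ((l, k), (j, i)) ((q, s), (h, r)) ((q', s'), (h', r')) := by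
    intro k s s'
    have h1 : S.toLinearMap (choi F.toLinearMap) = choi.symm (choi S.toLinearMap)
        (choi F.toLinearMap) := by rw [LinearEquiv.symm_apply_apply]
    rw [h1, choi_symm_apply, Fintype.sum_prod_type, Finset.sum_comm]
    refine Finset.sum_congr rfl fun i _ => ?_
    refine Finset.sum_congr rfl fun j _ => ?_
    rw [Fintype.sum_prod_type]
    refine Finset.sum_congr rfl fun h _ => ?_
    simp_rw [Fintype.sum_prod_type]
    rw [Finset.sum_comm]
  have h2 : S.onChannel F ρ l q q' = ∑ k, ∑ s, ∑ s', ρ k s s' *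
      S.toLinearMap (choi F.toLinearMap) (l, k) (q, s) (q', s') := rfl
  rw [h2]
  simp_rw [hS]

/-- A supermap whose Choi operator factors is implemented by the corresponding circuit. -/
theorem onChannel_eq_circuit {P : Type*} [Fintype P] [DecidableEq P] [DecidableEq I] [DecidableEq J]
    [DecidableEq K] (S : DeterministicSupermap hin hout kin kout)
    (E : ChoiAlg kin (fun i => hin i × P))
    (G : ChoiAlg (fun x : K × (I × J) => hout x.2.2 × P) kout)
    (hfac : ∀ l k j i q q' s s' h h' r r',
      choi S.toLinearMap ((l, k), (j, i)) ((q, s), (h, r)) ((q', s'), (h', r')) =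
        ∑ b, ∑ b', E (i, k) ((r, b), s) ((r', b'), s') *
          G (l, (k, (i, j))) (q, (h, b)) (q', (h', b')))
    (F : Channel hin hout) :
    S.onChannel F = circuit (choi.symm E) F.toLinearMap (choi.symm G) := by
  apply LinearMap.ext
  intro ρ
  funext l
  ext q q'
  have hF : F.toLinearMap = choi.symm (choi F.toLinearMap) :=
    (LinearEquiv.symm_apply_apply _ _).symm
  conv_rhs => rw [hF]
  rw [circuit_apply, choi_onChannel_apply]
  refine Finset.sum_congr rfl fun k _ => ?_
  -- Both sides are the same multiple sum; each index in turn is pulled out through the double sum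
  -- over `s, s'`, and later also through that over `b, b'`.
  simp_rw [Finset.mul_sum (s := (Finset.univ : Finset I))]
  rw [sum_sum_comm (J := kin k) (m := fun _ => kin k)]
  refine Finset.sum_congr rfl fun i _ => ?_
  simp_rw [Finset.mul_sum (s := (Finset.univ : Finset J))]
  rw [sum_sum_comm (J := kin k) (m := fun _ => kin k)]
  refine Finset.sum_congr rfl fun j _ => ?_
  simp_rw [Finset.mul_sum (s := (Finset.univ : Finset (hout j)))]
  rw [sum_sum_comm (J := kin k) (m := fun _ => kin k)]
  refine Finset.sum_congr rfl fun h _ => ?_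
  rw [sum_sum_comm (J := kin k) (m := fun _ => kin k), Finset.sum_comm (γ := P)]
  refine Finset.sum_congr rfl fun h' _ => ?_
  simp_rw [Finset.mul_sum (s := (Finset.univ : Finset (hin i)))]
  rw [sum_sum_comm (J := kin k) (m := fun _ => kin k)]
  simp_rw [Finset.sum_mul (s := (Finset.univ : Finset (hin i)))]
  rw [sum_sum_comm (J := P) (m := fun _ => P)]
  refine Finset.sum_congr rfl fun r _ => ?_
  rw [sum_sum_comm (J := kin k) (m := fun _ => kin k), sum_sum_comm (J := P) (m := fun _ => P)]
  refine Finset.sum_congr rfl fun r' _ => ?_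
  simp_rw [hfac, Finset.mul_sum, Finset.sum_mul]
  rw [sum_sum_comm (J := kin k) (m := fun _ => kin k)]
  refine Finset.sum_congr rfl fun b _ => ?_
  rw [sum_sum_comm (J := kin k) (m := fun _ => kin k)]
  refine Finset.sum_congr rfl fun b' _ => ?_
  refine Finset.sum_congr rfl fun s _ => ?_
  refine Finset.sum_congr rfl fun s' _ => ?_
  ring

end Realization

/-! ### Compression and its inverse -/

section Dilation

open scoped Kronecker
open Matrix

/-- Undoing the compression by the pseudo-inverse `Q` of `W` recovers a matrix supported on
`Z ⊗ supp (W Wᴴ)`, whatever is added on the complement of the support. -/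
theorem dilate_compress {X Y Z : Type*} [Fintype X] [DecidableEq X] [Fintype Y] [DecidableEq Y]
    [Fintype Z] [DecidableEq Z] {M : Matrix (Z × X) (Z × X) ℂ} (hM : M.PosSemidef)
    {N : Matrix X X ℂ} {W : Matrix X Y ℂ} {Q : Matrix Y X ℂ} (hW : W * Wᴴ = N)
    (hQ : W * Q * N = N)
    (hN : ∀ z, (N - Matrix.of fun x x' => M (z, x) (z, x')).PosSemidef) (D : Matrix Z Z ℂ) :
    ((1 : Matrix Z Z ℂ) ⊗ₖ W) * (((1 : Matrix Z Z ℂ) ⊗ₖ Q) * M * ((1 : Matrix Z Z ℂ) ⊗ₖ Q)ᴴ +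
      D ⊗ₖ (1 - Q * N * Qᴴ)) * ((1 : Matrix Z Z ℂ) ⊗ₖ W)ᴴ = M := by
  have hNh : Nᴴ = N := by rw [← hW, conjTranspose_mul, conjTranspose_conjTranspose]
  have h1 := kronecker_mul_eq_self hM hN hNh hQ
  have h2 : M * ((1 : Matrix Z Z ℂ) ⊗ₖ (W * Q))ᴴ = M := by
    have := congrArg conjTranspose h1
    rwa [conjTranspose_mul, hM.isHermitian.eq] at this
  have h3 : (1 : Matrix Z Z ℂ) ⊗ₖ (W * Q) =
      ((1 : Matrix Z Z ℂ) ⊗ₖ W) * ((1 : Matrix Z Z ℂ) ⊗ₖ Q) := by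
    rw [← mul_kronecker_mul, Matrix.one_mul]
  -- The completion term is invisible through `W`, which makes `D` arbitrary.
  have h4 : W * (1 - Q * N * Qᴴ) * Wᴴ = 0 := by
    have h5 : N * (Qᴴ * Wᴴ) = N := by
      have := congrArg conjTranspose hQ
      rwa [conjTranspose_mul, conjTranspose_mul, hNh] at this
    calc W * (1 - Q * N * Qᴴ) * Wᴴ = W * Wᴴ - W * Q * N * (Qᴴ * Wᴴ) := by
          rw [Matrix.mul_sub, Matrix.sub_mul, Matrix.mul_one]
          simp only [Matrix.mul_assoc]
      _ = 0 := by rw [hQ, h5, hW, sub_self]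
  have h6 :
      ((1 : Matrix Z Z ℂ) ⊗ₖ W) * (D ⊗ₖ (1 - Q * N * Qᴴ)) * ((1 : Matrix Z Z ℂ) ⊗ₖ W)ᴴ = 0 := by
    rw [conjTranspose_kronecker, ← mul_kronecker_mul, ← mul_kronecker_mul, h4, kronecker_zero]
  rw [Matrix.mul_add, Matrix.add_mul, h6, add_zero]
  calc _ = ((1 : Matrix Z Z ℂ) ⊗ₖ (W * Q)) * M * ((1 : Matrix Z Z ℂ) ⊗ₖ (W * Q))ᴴ := by
        rw [h3, conjTranspose_mul]
        simp only [Matrix.mul_assoc]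
    _ = M := by rw [h1, h2]

theorem sum_sub_posSemidef {X Y : Type*} [Fintype Y] [DecidableEq Y] {B : Y → Matrix X X ℂ}
    (hB : ∀ y, (B y).PosSemidef) (y₀ : Y) : ((∑ y, B y) - B y₀).PosSemidef := by
  rw [← Finset.sum_erase_eq_sub (Finset.mem_univ y₀)]
  exact Matrix.posSemidef_sum _ fun y _ => hB y

end Dilation

/-! ### The encoder, the decoder and the circuit -/

namespace DeterministicSupermap

open scoped Kronecker
open Matrix

variable {I J K L : Type*} {hin : I → Type*} {hout : J → Type*} {kin : K → Type*} {kout : L → Type*}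
  [Fintype I] [Fintype J] [Fintype K] [Fintype L]
  [∀ i, Fintype (hin i)] [∀ j, Fintype (hout j)] [∀ k, Fintype (kin k)] [∀ l, Fintype (kout l)]
  [∀ i, DecidableEq (hin i)] [∀ j, DecidableEq (hout j)] [∀ k, DecidableEq (kin k)]
  [∀ l, DecidableEq (kout l)]

/-- A state of the output algebra, as long as a circuit needs one. -/
theorem exists_output_weights (S : DeterministicSupermap hin hout kin kout) :
    ∃ w : (l : L) → kout l → ℂ, (∀ l q, 0 ≤ w l q) ∧
      ∀ (j : J) (_ : hout j) (k : K) (_ : kin k), ∑ l, ∑ q, w l q = 1 := by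
  classical
  by_cases h : ∃ l, Nonempty (kout l)
  · obtain ⟨l₀, ⟨q₀⟩⟩ := h
    refine ⟨fun l q => if (⟨l, q⟩ : (l : L) × kout l) = ⟨l₀, q₀⟩ then 1 else 0, ?_, ?_⟩
    · intro l q
      dsimp only
      split_ifs
      · exact zero_le_one
      · exact le_rfl
    · intro _ _ _ _
      exact sum_indicator _
  · exact ⟨fun _ _ => 0, fun _ _ => le_rfl, fun _ h' _ s => (h (S.exists_output h' s)).elim⟩

variable [DecidableEq I] [DecidableEq J]

/-- The Choi matrix of a block of a supermap, with the outputs of the supermap and of the channel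
grouped together, and likewise the inputs. -/
def regroupedChoi (S : DeterministicSupermap hin hout kin kout) (l : L) (k : K) (j : J) (i : I) :
    Matrix ((kout l × hout j) × (kin k × hin i)) ((kout l × hout j) × (kin k × hin i)) ℂ :=
  Matrix.of fun x y => choi S.toLinearMap ((l, k), (j, i))
    ((x.1.1, x.2.1), (x.1.2, x.2.2)) ((y.1.1, y.2.1), (y.1.2, y.2.2))

theorem regroupedChoi_posSemidef (S : DeterministicSupermap hin hout kin kout)
    (l : L) (k : K) (j : J) (i : I) : (S.regroupedChoi l k j i).PosSemidef :=
  (choi_posSemidef S.toCompletelyPositiveMap (l, k) (j, i)).submatrix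
    (fun x : (kout l × hout j) × (kin k × hin i) => ((x.1.1, x.2.1), (x.1.2, x.2.2)))

/-- The Choi operator of the first channel of the circuit, given by Kraus operators `W k i`. -/
def encoderChoi {P : Type*} (W : (k : K) → (i : I) → Matrix (kin k × hin i) P ℂ) :
    ChoiAlg kin (fun i => hin i × P) := fun x => CStarMatrix.ofMatrix <|
  Matrix.of fun y y' => W x.2 x.1 (y.2, y.1.1) y.1.2 * star (W x.2 x.1 (y'.2, y'.1.1) y'.1.2)

theorem encoderChoi_posSemidef {P : Type*} [Fintype P]
    (W : (k : K) → (i : I) → Matrix (kin k × hin i) P ℂ) (i : I) (k : K) :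
    (Matrix.of fun p q => encoderChoi W (i, k) p q).PosSemidef :=
  posSemidef_vecMulVec_self_star (fun y : (hin i × P) × kin k => W k i (y.2, y.1.1) y.1.2)

theorem sum_encoderChoi {P : Type*} [Fintype P]
    (W : (k : K) → (i : I) → Matrix (kin k × hin i) P ℂ) (k : K) (s s' : kin k) :
    ∑ i, ∑ p, encoderChoi W (i, k) (p, s) (p, s') =
      ∑ i, ∑ r, (W k i * (W k i)ᴴ) (s, r) (s', r) := by
  refine Finset.sum_congr rfl fun i _ => ?_
  rw [Fintype.sum_prod_type]
  rfl

variable {P : Type*} [Fintype P] [DecidableEq P] (w : (l : L) → kout l → ℂ)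
  (N : (k : K) → (i : I) → Matrix (kin k × hin i) (kin k × hin i) ℂ)
  (Q : (k : K) → (i : I) → Matrix P (kin k × hin i) ℂ)

/-- A block of the Choi operator of the last channel of the circuit. The first summand is the
compression by `Q`; the second one completes it to a trace-preserving map. -/
def decoderBlock (S : DeterministicSupermap hin hout kin kout) (l : L) (k : K) (i : I) (j : J) :
    Matrix ((kout l × hout j) × P) ((kout l × hout j) × P) ℂ :=
  ((1 : Matrix (kout l × hout j) (kout l × hout j) ℂ) ⊗ₖ Q k i) * S.regroupedChoi l k j i *
    ((1 : Matrix (kout l × hout j) (kout l × hout j) ℂ) ⊗ₖ Q k i)ᴴ +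
    (diagonal fun z : kout l × hout j => w l z.1) ⊗ₖ (1 - Q k i * N k i * (Q k i)ᴴ)

/-- The Choi operator of the last channel of the circuit. -/
def decoderChoi (S : DeterministicSupermap hin hout kin kout) :
    ChoiAlg (fun x : K × (I × J) => hout x.2.2 × P) kout := fun x =>
  CStarMatrix.ofMatrix <| Matrix.of fun y y' => S.decoderBlock w N Q x.1 x.2.1 x.2.2.1 x.2.2.2
    ((y.1, y.2.1), y.2.2) ((y'.1, y'.2.1), y'.2.2)

theorem decoderChoi_posSemidef (S : DeterministicSupermap hin hout kin kout)
    (hw : ∀ l q, 0 ≤ w l q) (hπ : ∀ k i, (1 - Q k i * N k i * (Q k i)ᴴ).PosSemidef)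
    (l : L) (x : K × (I × J)) :
    (Matrix.of fun p q => S.decoderChoi w N Q (l, x) p q).PosSemidef := by
  have hd : (diagonal fun z : kout l × hout x.2.2 => w l z.1).PosSemidef :=
    PosSemidef.diagonal fun z => hw l z.1
  have h : (S.decoderBlock w N Q l x.1 x.2.1 x.2.2).PosSemidef := by
    rw [decoderBlock]
    exact ((S.regroupedChoi_posSemidef l x.1 x.2.2 x.2.1).mul_mul_conjTranspose_same _).add
      (hd.kronecker (hπ x.1 x.2.1))
  exact h.submatrix (fun y : kout l × (hout x.2.2 × P) => ((y.1, y.2.1), y.2.2))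

/-- The compressed part traces to `1 ⊗ Q N Qᴴ` by the marginal property, and the completion,
weighted by a state, supplies the missing `1 ⊗ (1 - Q N Qᴴ)`. -/
theorem sum_decoderChoi (S : DeterministicSupermap hin hout kin kout)
    (hNS : ∀ k i j h h' s s' r r',
        ∑ l, ∑ q, choi S.toLinearMap ((l, k), (j, i)) ((q, s), (h, r)) ((q, s'), (h', r')) =
          if h = h' then N k i (s, r) (s', r') else 0)
    (k : K) (i : I) (j : J) (h h' : hout j) (b b' : P) (hw : ∑ l, ∑ q, w l q = 1) :
    ∑ l, ∑ q, S.decoderChoi w N Q (l, (k, (i, j))) (q, (h, b)) (q, (h', b')) =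
      if (h, b) = (h', b') then 1 else 0 := by
  have h1 : ∀ l q, S.decoderChoi w N Q (l, (k, (i, j))) (q, (h, b)) (q, (h', b')) =
      (Q k i * (Matrix.of fun x x' => S.regroupedChoi l k j i ((q, h), x) ((q, h'), x')) *
        (Q k i)ᴴ) b b' +
      w l q * ((if h = h' then 1 else 0) *
        (1 - Q k i * N k i * (Q k i)ᴴ : Matrix P P ℂ) b b') := by
    intro l q
    have : S.decoderChoi w N Q (l, (k, (i, j))) (q, (h, b)) (q, (h', b')) =
      S.decoderBlock w N Q l k i j ((q, h), b) ((q, h'), b') := rfl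
    rw [this, decoderBlock, Matrix.add_apply, one_kronecker_conj_apply, kroneckerMap_apply,
      diagonal_apply]
    by_cases hh : h = h' <;> simp [hh]
  have h2 : ∑ l, ∑ q,
      (Matrix.of fun x x' => S.regroupedChoi l k j i ((q, h), x) ((q, h'), x')) =
      (if h = h' then (1 : ℂ) else 0) • N k i := by
    ext x x'
    simp only [Matrix.sum_apply]
    refine (hNS k i j h h' x.1 x'.1 x.2 x'.2).trans ?_
    split_ifs <;> simp
  simp_rw [h1, Finset.sum_add_distrib, ← Finset.sum_mul]
  rw [hw, one_mul]
  simp_rw [← Matrix.sum_apply, ← Matrix.sum_mul, ← Matrix.mul_sum]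
  rw [h2, Matrix.mul_smul, Matrix.smul_mul, Matrix.smul_apply, smul_eq_mul, Matrix.sub_apply,
    Matrix.one_apply]
  by_cases hh : h = h' <;> simp [hh]

/-- For fixed `h`, the diagonal blocks over all outputs `(l, q)` are positive and sum to `N k i`;
the difference is the sum of the others. -/
theorem sub_block_regroupedChoi_posSemidef (S : DeterministicSupermap hin hout kin kout)
    (hNS : ∀ k i j h h' s s' r r',
        ∑ l, ∑ q, choi S.toLinearMap ((l, k), (j, i)) ((q, s), (h, r)) ((q, s'), (h', r')) =
          if h = h' then N k i (s, r) (s', r') else 0)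
    (l : L) (k : K) (j : J) (i : I) (z : kout l × hout j) :
    (N k i - Matrix.of fun x x' => S.regroupedChoi l k j i (z, x) (z, x')).PosSemidef := by
  classical
  obtain ⟨q, h⟩ := z
  let B : ((l : L) × kout l) → Matrix (kin k × hin i) (kin k × hin i) ℂ := fun y =>
    (S.regroupedChoi y.1 k j i).submatrix (fun x => ((y.2, h), x)) (fun x => ((y.2, h), x))
  have hB : ∑ y, B y = N k i := by
    ext x x'
    have h1 := hNS k i j h h x.1 x'.1 x.2 x'.2
    rw [if_pos rfl] at h1
    rw [Matrix.sum_apply, Fintype.sum_sigma]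
    exact h1
  have h2 := sum_sub_posSemidef (fun y => (S.regroupedChoi_posSemidef y.1 k j i).submatrix
    (fun x => ((y.2, h), x)) : ∀ y, (B y).PosSemidef) ⟨l, q⟩
  rw [hB] at h2
  exact h2

theorem choi_eq_sum_encoderChoi_mul_decoderChoi (S : DeterministicSupermap hin hout kin kout)
    (hNS : ∀ k i j h h' s s' r r',
        ∑ l, ∑ q, choi S.toLinearMap ((l, k), (j, i)) ((q, s), (h, r)) ((q, s'), (h', r')) =
          if h = h' then N k i (s, r) (s', r') else 0)
    {W : (k : K) → (i : I) → Matrix (kin k × hin i) P ℂ} (hW : ∀ k i, W k i * (W k i)ᴴ = N k i)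
    (hQ : ∀ k i, W k i * Q k i * N k i = N k i)
    (l : L) (k : K) (j : J) (i : I) (q q' : kout l) (s s' : kin k) (h h' : hout j) (r r' : hin i) :
    choi S.toLinearMap ((l, k), (j, i)) ((q, s), (h, r)) ((q', s'), (h', r')) =
      ∑ b, ∑ b', encoderChoi W (i, k) ((r, b), s) ((r', b'), s') *
        S.decoderChoi w N Q (l, (k, (i, j))) (q, (h, b)) (q', (h', b')) := by
  have h1 := congrFun (congrFun (dilate_compress (S.regroupedChoi_posSemidef l k j i) (hW k i)
    (hQ k i) (S.sub_block_regroupedChoi_posSemidef N hNS l k j i)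
    (diagonal fun z : kout l × hout j => w l z.1)) ((q, h), (s, r))) ((q', h'), (s', r'))
  refine (h1.symm.trans (one_kronecker_conj_apply (W k i) (S.decoderBlock w N Q l k i j)
    (q, h) (q', h') (s, r) (s', r'))).trans ?_
  simp only [Matrix.mul_apply, Finset.sum_mul]
  rw [Finset.sum_comm]
  refine Finset.sum_congr rfl fun b _ => ?_
  refine Finset.sum_congr rfl fun b' _ => ?_
  have h3 : S.decoderChoi w N Q (l, (k, (i, j))) (q, (h, b)) (q', (h', b')) =
    S.decoderBlock w N Q l k i j ((q, h), b) ((q', h'), b') := rfl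
  have h4 : encoderChoi W (i, k) ((r, b), s) ((r', b'), s') =
    W k i (s, r) b * star (W k i (s', r') b') := rfl
  rw [h3, h4, conjTranspose_apply, Matrix.of_apply, mul_right_comm]

/-- Every deterministic supermap is implemented by a circuit, with any ancilla that is large
enough, provided the ancilla is zero whenever `C` is. -/
theorem exists_circuit [DecidableEq K] (S : DeterministicSupermap hin hout kin kout)
    (hP : ∀ i k, Fintype.card (hin i) * Fintype.card (kin k) ≤ Fintype.card P)
    (hP' : Nonempty P → ∃ k, Nonempty (kin k)) :
    ∃ (E : Channel kin (fun i => hin i × P))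
      (G : Channel (fun x : K × (I × J) => hout x.2.2 × P) kout),
      ∀ F : Channel hin hout,
        S.onChannel F = circuit E.toLinearMap F.toLinearMap G.toLinearMap := by
  obtain ⟨N, hN, hN1, hNS⟩ := S.exists_marginal
  obtain ⟨w, hw, hw1⟩ := S.exists_output_weights
  choose W Q hW hQ hπ using fun k i => exists_factorization (Y := P) (hN k i)
    (by rw [Fintype.card_prod, mul_comm]; exact hP i k)
  refine ⟨channelOfChoi (encoderChoi W) (encoderChoi_posSemidef W) ?_,
    channelOfChoi (S.decoderChoi w N Q) (S.decoderChoi_posSemidef w N Q hw hπ) ?_, fun F => ?_⟩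
  · intro k s s'
    rw [sum_encoderChoi, ← hN1 k s s']
    simp_rw [hW]
  · rintro ⟨k, i, j⟩ ⟨h, b⟩ ⟨h', b'⟩
    obtain ⟨k₀, ⟨s₀⟩⟩ := hP' ⟨b⟩
    exact S.sum_decoderChoi w N Q hNS k i j h h' b b' (hw1 j h k₀ s₀)
  · exact onChannel_eq_circuit S _ _
      (S.choi_eq_sum_encoderChoi_mul_decoderChoi w N Q hNS hW hQ) F

end DeterministicSupermap

end Supermaps

theorem theorem1
    {I J K L : Type*} [Fintype I] [Fintype J] [Fintype K] [Fintype L]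
    [DecidableEq I] [DecidableEq K]
    {hin : I → Type*} {hout : J → Type*} {kin : K → Type*} {kout : L → Type*}
    [∀ i, Fintype (hin i)] [∀ j, Fintype (hout j)]
    [∀ k, Fintype (kin k)] [∀ l, Fintype (kout l)]
    [∀ i, DecidableEq (hin i)] [∀ j, DecidableEq (hout j)]
    [∀ k, DecidableEq (kin k)] [∀ l, DecidableEq (kout l)]
    (S : Supermaps.DeterministicSupermap hin hout kin kout) :
    ∃ p : ℕ,
      p ≤ Finset.univ.sup (fun x : I × K => Fintype.card (hin x.1) * Fintype.card (kin x.2)) ∧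
      ∃ (E : Supermaps.Channel kin (fun i => hin i × Fin p))
        (G : Supermaps.Channel (fun x : K × (I × J) => hout x.2.2 × Fin p) kout),
        ∀ F : Supermaps.Channel hin hout,
          S.onChannel F =
            Supermaps.circuit E.toLinearMap F.toLinearMap G.toLinearMap := by
  classical
  -- The ancilla has exactly the maximal dimension, so a single one accommodates all pairs `(i, k)`.
  refine ⟨_, le_rfl, S.exists_circuit ?_ ?_⟩
  · intro i k
    rw [Fintype.card_fin]
    exact Finset.le_sup (f := fun x : I × K => Fintype.card (hin x.1) * Fintype.card (kin x.2))
      (Finset.mem_univ (i, k))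
  -- If `C = 0`, all the products vanish and so does the ancilla.
  · rintro ⟨b⟩
    by_contra! h
    have h0 : Finset.univ.sup
        (fun x : I × K => Fintype.card (hin x.1) * Fintype.card (kin x.2)) = 0 := by
      rw [← bot_eq_zero, Finset.sup_eq_bot_iff]
      intro x _
      rw [bot_eq_zero, Fintype.card_eq_zero_iff.mpr (h x.2), mul_zero]
    exact Nat.not_lt_zero b.val (b.isLt.trans_eq h0)
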